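/- Let $d\ge 2$ and $n\ge d+1$ be integers. A $d$-dimensional polytope in $\mathbb{R}^d$ is the convex hull $P$ of a finite set of points whose affine hull is $\mathbb{R}^d$; let $\mathcal{V}(P)$ denote its vertex set. A point $x\in\mathbb{R}^d\setminus P$ can be inserted in $P$ if the vertex set of $\mathrm{conv}(P\cup\{x\})$ is $\mathcal{V}(P)\cup\{x\}$; the insertion move then transforms $P$ into $\mathrm{conv}(P\cup\{x\})$. A vertex $v$ of $P$ can be deleted from $P$ if $\mathrm{conv}(\mathcal{V}(P)\setminus\{v\})$ is $d$-dimensional; the deletion move then transforms $P$ into $\mathrm{conv}(\mathcal{V}(P)\setminus\{v\})$. Let $\Gamma(d)$ be the graph whose vertices are all the $d$-dimensional polytopes in $\mathbb{R}^d$ and whose edges connect any two distinct polytopes such that one is obtained from the other by an insertion or a deletion move. Then the subgraph induced in $\Gamma(d)$ by the polytopes with $n$ or $n+1$ vertices is connected, its diameter is at least $4n-2d$ and at most $6n-2$, and any two polytopes with exactly $n$ vertices have distance at most $6n-4$ in this subgraph. -/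

import Mathlib

namespace PolytopeGraph

/-- A `d`-dimensional polytope contained in `ℝ^d`: the convex hull of finitely many points,
whose affine hull is the whole space. -/
structure Polytope (d : ℕ) where
  /-- The polytope, as a set of points. -/
  carrier : Set (EuclideanSpace ℝ (Fin d))
  isHull : ∃ S : Finset (EuclideanSpace ℝ (Fin d)), carrier = convexHull ℝ (S : Set _)
  fullDim : affineSpan ℝ carrier = ⊤

/-- The vertex set of a polytope: its set of extreme points. -/
def Polytope.vertices {d : ℕ} (P : Polytope d) : Set (EuclideanSpace ℝ (Fin d)) :=
  P.carrier.extremePoints ℝ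

/-- The number of vertices of a polytope (its vertex set is always finite). -/
noncomputable def Polytope.numVertices {d : ℕ} (P : Polytope d) : ℕ :=
  P.vertices.ncard

/-- A point `x` outside of `P` can be inserted in `P` if the vertex set of the convex hull of
`P ∪ {x}` consists of `x` and all the vertices of `P`. -/
def Polytope.CanInsert {d : ℕ} (P : Polytope d) (x : EuclideanSpace ℝ (Fin d)) : Prop :=
  x ∉ P.carrier ∧
    (convexHull ℝ (P.carrier ∪ {x})).extremePoints ℝ = P.vertices ∪ {x}

/-- A vertex `v` of `P` can be deleted from `P` if the convex hull of the other vertices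
is still `d`-dimensional. -/
def Polytope.CanDelete {d : ℕ} (P : Polytope d) (v : EuclideanSpace ℝ (Fin d)) : Prop :=
  v ∈ P.vertices ∧ affineSpan ℝ (convexHull ℝ (P.vertices \ {v})) = ⊤

/-- `Q` is obtained from `P` by an insertion move. -/
def IsInsertionMove {d : ℕ} (P Q : Polytope d) : Prop :=
  ∃ x, P.CanInsert x ∧ Q.carrier = convexHull ℝ (P.carrier ∪ {x})

/-- `Q` is obtained from `P` by a deletion move. -/
def IsDeletionMove {d : ℕ} (P Q : Polytope d) : Prop :=
  ∃ v, P.CanDelete v ∧ Q.carrier = convexHull ℝ (P.vertices \ {v})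

/-- The graph `Γ(d)` on the `d`-dimensional polytopes contained in `ℝ^d`: two distinct polytopes
are adjacent when one is obtained from the other by an insertion move or a deletion move. -/
def Gamma (d : ℕ) : SimpleGraph (Polytope d) :=
  SimpleGraph.fromRel fun P Q => IsInsertionMove P Q ∨ IsDeletionMove P Q

/-- The polytopes with `n` or `n + 1` vertices. -/
def level (d n : ℕ) : Set (Polytope d) :=
  {P | P.numVertices = n ∨ P.numVertices = n + 1}

/-- The subgraph induced in `Γ(d)` by the polytopes with `n` or `n + 1` vertices. -/
def GammaLevel (d n : ℕ) : SimpleGraph (level d n) :=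
  (Gamma d).induce (level d n)

end PolytopeGraph

/-
For the upper bound, one deletion in each polytope that needs it leaves `P` and `Q` with `n`
vertices each. Let `v` and `w` be vertices of `P` and `Q` at maximal distance. All vertices of `P`
lie in the ball about `w` whose boundary sphere contains `v`, so they can be exchanged one by one,
`v` excepted, for points of that sphere close to `v`: this takes `2 (n - 1)` moves, and the
exchange property of affine spans keeps every intermediate polytope full-dimensional. Doing the
same with `Q` on the sphere about `v` through `w` leaves two polytopes whose vertices are jointly
in convex position, because each of the two balls contains all of them; `2 n` moves then exchange
the ones for the others.

For the lower bound, `P` and `Q` are iterated pyramids over polygons inscribed in opposite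
parabolas. The apices come in pairs, with one apex common to `P` and `Q` left over when `d` is odd:
the two apices of `P` and the two apices of `Q` in a pair lie on a line, which contains at most two
vertices of any polytope. Consider the first polytope on a path from `P` to `Q` that has a base
vertex of `Q`. It has only one, which together with three base vertices of `P` would not be in
convex position, so it has at most two of the latter. Hence it shares at most `d + 2` vertices with
`P` and `Q` in total. Since `P`, `Q` and this polytope have `n + 1` vertices and a move changes one
vertex, the path has at least `4 (n + 1) - 2 (d + 2)` moves.
-/

open scoped Topology symmDiff RealInnerProductSpace

namespace PolytopeGraph

theorem convexIndependent_of_forall_exists_lt {𝕜 E : Type*} [Field 𝕜] [LinearOrder 𝕜]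
    [IsStrictOrderedRing 𝕜] [AddCommGroup E] [Module 𝕜 E] {s : Set E}
    (h : ∀ x ∈ s, ∃ f : E →ₗ[𝕜] 𝕜, ∀ y ∈ s, y ≠ x → f x < f y) :
    ConvexIndependent 𝕜 ((↑) : s → E) := by
  rw [convexIndependent_set_iff_notMem_convexHull_sdiff]
  intro x hx hmem
  obtain ⟨f, hf⟩ := h x hx
  have hsub : s \ {x} ⊆ {y | f x < f y} := fun y hy => hf y hy.1 hy.2
  exact lt_irrefl (f x) (convexHull_min hsub (convex_halfSpace_gt f.isLinear _) hmem)

section LocallyConvex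

variable {E : Type*} [AddCommGroup E] [Module ℝ E] [TopologicalSpace E] [T2Space E]
  [IsTopologicalAddGroup E] [ContinuousSMul ℝ E] [LocallyConvexSpace ℝ E]

theorem extremePoints_convexHull_of_convexIndependent {s : Set E} (hs : s.Finite)
    (hc : ConvexIndependent ℝ ((↑) : s → E)) : (convexHull ℝ s).extremePoints ℝ = s := by
  refine extremePoints_convexHull_subset.antisymm ?_
  have hmem : s ⊆ convexHull ℝ ((convexHull ℝ s).extremePoints ℝ) := by
    have hfin := hs.subset (extremePoints_convexHull_subset (𝕜 := ℝ))
    rw [← (hfin.isClosed_convexHull ℝ).closure_eq,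
      closure_convexHull_extremePoints (hs.isCompact_convexHull ℝ) (convex_convexHull ℝ s)]
    exact subset_convexHull ℝ s
  exact fun x hx => convexIndependent_set_iff_inter_convexHull_subset.1 hc _
    extremePoints_convexHull_subset ⟨hx, hmem hx⟩

theorem eventually_smallSets_notMem_convexHull_union {s : Set E} (hs : s.Finite) {v x : E}
    (hv : v ∈ s) (hx : x ∉ convexHull ℝ s) :
    ∀ᶠ U in (𝓝 v).smallSets, x ∉ convexHull ℝ (s ∪ U) := by
  obtain ⟨f, u, hfs, hux⟩ := geometric_hahn_banach_closed_point (convex_convexHull ℝ s)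
    (hs.isClosed_convexHull ℝ) hx
  have hsu : s ⊆ {z | f z < u} := fun z hz => hfs z (subset_convexHull ℝ s hz)
  have hopen : {z | f z < u} ∈ 𝓝 v := (isOpen_lt f.continuous continuous_const).mem_nhds (hsu hv)
  filter_upwards [Filter.eventually_smallSets_subset.2 hopen] with U hU hxU
  exact hux.not_gt (convexHull_min (Set.union_subset hsu hU)
    (convex_halfSpace_lt f.toLinearMap.isLinear u) hxU)

end LocallyConvex

section StrictConvex

variable {E : Type*} [NormedAddCommGroup E] [NormedSpace ℝ E] [StrictConvexSpace ℝ E]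

theorem notMem_convexHull_sdiff_of_mem_sphere {s : Set E} {c x : E} {r : ℝ}
    (hr : r ≠ 0) (hs : s ⊆ Metric.closedBall c r) (hx : x ∈ Metric.sphere c r) :
    x ∉ convexHull ℝ (s \ {x}) := by
  have hext := StrictConvexSpace.sphere_subset_extremePoints_closedBall c hr hx
  rw [(convex_closedBall c r).mem_extremePoints_iff_mem_sdiff_convexHull_sdiff] at hext
  exact fun h => hext.2 (convexHull_mono (Set.sdiff_subset_sdiff_left hs) h)

theorem convexIndependent_union_of_subset_sphere {s t : Set E} {v w : E}
    {r : ℝ} (hr : r ≠ 0) (hs : s ⊆ Metric.sphere w r ∩ Metric.closedBall v r)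
    (ht : t ⊆ Metric.sphere v r ∩ Metric.closedBall w r) :
    ConvexIndependent ℝ ((↑) : (s ∪ t : Set E) → E) := by
  obtain ⟨hsw, hsv⟩ := Set.subset_inter_iff.1 hs
  obtain ⟨htv, htw⟩ := Set.subset_inter_iff.1 ht
  rw [convexIndependent_set_iff_notMem_convexHull_sdiff]
  rintro x (hx | hx)
  · exact notMem_convexHull_sdiff_of_mem_sphere hr
      (Set.union_subset (hsw.trans Metric.sphere_subset_closedBall) htw) (hsw hx)
  · exact notMem_convexHull_sdiff_of_mem_sphere hr
      (Set.union_subset hsv (htv.trans Metric.sphere_subset_closedBall)) (htv hx)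

theorem eventually_smallSets_convexIndependent_union_sphere {s : Set E}
    (hs : s.Finite) (hc : ConvexIndependent ℝ ((↑) : s → E)) {v w : E} (hv : v ∈ s) (hvw : v ≠ w)
    (hsw : s ⊆ Metric.closedBall w (dist v w)) :
    ∀ᶠ U in (𝓝 v).smallSets,
      ConvexIndependent ℝ ((↑) : (s ∪ Metric.sphere w (dist v w) ∩ U : Set E) → E) := by
  rw [convexIndependent_set_iff_notMem_convexHull_sdiff] at hc
  have hne : ∀ᶠ U in (𝓝 v).smallSets, ∀ x ∈ s \ {v}, x ∉ convexHull ℝ (s \ {x} ∪ U) :=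
    (Filter.eventually_all_finite hs.sdiff).2 fun x hx =>
      eventually_smallSets_notMem_convexHull_union hs.sdiff ⟨hv, Ne.symm hx.2⟩ (hc x hx.1)
  filter_upwards [hne] with U hU
  rw [convexIndependent_set_iff_notMem_convexHull_sdiff]
  intro x hx
  by_cases hxS : x ∈ Metric.sphere w (dist v w)
  · exact notMem_convexHull_sdiff_of_mem_sphere (dist_ne_zero.2 hvw) (Set.union_subset hsw
      (Set.inter_subset_left.trans Metric.sphere_subset_closedBall)) hxS
  · have hxs : x ∈ s \ {v} := ⟨hx.resolve_right fun h => hxS h.1, fun h => hxS (h ▸ rfl)⟩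
    refine fun hmem => hU x hxs (convexHull_mono ?_ hmem)
    rw [Set.union_sdiff_distrib]
    exact Set.union_subset_union_right _ (Set.sdiff_subset.trans Set.inter_subset_right)

end StrictConvex

section Sphere

open EuclideanGeometry

variable {V P : Type*} [NormedAddCommGroup V] [InnerProductSpace ℝ V] [MetricSpace P]
  [NormedAddTorsor V P]

theorem exists_ne_zero_inner_eq_zero (hV : 1 < Module.rank ℝ V) (a : V) :
    ∃ f : V, f ≠ 0 ∧ ⟪f, a⟫ = 0 := by
  have hbot : (ℝ ∙ a)ᗮ ≠ ⊥ := by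
    rw [ne_eq, Submodule.orthogonal_eq_bot_iff]
    intro htop
    have hle := rank_span_le (R := ℝ) ({a} : Set V)
    rw [htop, rank_top, Cardinal.mk_singleton] at hle
    exact hV.not_ge hle
  obtain ⟨f, hf, hf0⟩ := Submodule.exists_mem_ne_zero_of_ne_bot hbot
  exact ⟨f, hf0, Submodule.mem_orthogonal_singleton_iff_inner_left.1 hf⟩

theorem dense_setOf_inner_ne_zero {a : V} (ha : a ≠ 0) : Dense {y : V | ⟪y, a⟫ ≠ 0} := by
  have hcompl : {y : V | ⟪y, a⟫ ≠ 0} = ((ℝ ∙ a)ᗮ : Set V)ᶜ := by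
    ext y
    simp [Submodule.mem_orthogonal_singleton_iff_inner_left]
  rw [hcompl, ← interior_eq_empty_iff_dense_compl, ← Set.not_nonempty_iff_eq_empty]
  intro hint
  have htop := Submodule.eq_top_of_nonempty_interior' _ hint
  rw [Submodule.orthogonal_eq_top_iff, Submodule.span_singleton_eq_bot] at htop
  exact ha htop

theorem continuousAt_secondInter (s : Sphere P) (p : P) {y : V} (hy : y ≠ 0) :
    ContinuousAt (s.secondInter p) y := by
  have hyy : ⟪y, y⟫ ≠ 0 := inner_self_ne_zero.2 hy
  unfold Sphere.secondInter
  fun_prop (disch := assumption)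

theorem mem_vectorSpan_of_secondInter_mem {s : Sphere P} {p : P} {A : Set P} (hpA : p ∈ A) {y : V}
    (hy : ⟪y, p -ᵥ s.center⟫ ≠ 0) (hyA : s.secondInter p y ∈ A) : y ∈ vectorSpan ℝ A := by
  have hy0 : y ≠ 0 := by
    rintro rfl
    exact hy (inner_zero_left _)
  have hmem := vsub_mem_vectorSpan ℝ hyA hpA
  rw [Sphere.secondInter, vadd_vsub] at hmem
  refine (Submodule.smul_mem_iff _ ?_).1 hmem
  exact div_ne_zero (mul_ne_zero (by norm_num) hy) (inner_self_ne_zero.2 hy0)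

/- The line through `v` in a direction `y` meets the sphere again at a point that tends to `v` when
`y` tends to a tangent direction `f`, so the span contains all non-tangent `y` close to `f`. -/
theorem affineSpan_sphere_inter_of_mem_nhds (hV : 1 < Module.rank ℝ V) {v w : P} (hvw : v ≠ w)
    {U : Set P} (hU : U ∈ 𝓝 v) : affineSpan ℝ (Metric.sphere w (dist v w) ∩ U) = ⊤ := by
  let S : Sphere P := ⟨w, dist v w⟩
  have hv : v ∈ Metric.sphere w (dist v w) ∩ U := ⟨rfl, mem_of_mem_nhds hU⟩
  obtain ⟨f, hf0, hf⟩ := exists_ne_zero_inner_eq_zero hV (v -ᵥ w)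
  have hfv : S.secondInter v f = v := Sphere.secondInter_eq_self_iff.2 hf
  have hnear : ∀ᶠ y in 𝓝 f, S.secondInter v y ∈ U :=
    (continuousAt_secondInter S v hf0).eventually_mem (hfv.symm ▸ hU)
  obtain ⟨O, hOU, hO, hfO⟩ := mem_nhds_iff.1 hnear
  have hsub : O ∩ {y | ⟪y, v -ᵥ w⟫ ≠ 0} ⊆ vectorSpan ℝ (Metric.sphere w (dist v w) ∩ U) :=
    fun y hy => mem_vectorSpan_of_secondInter_mem (s := S) hv hy.2
      ⟨(Sphere.secondInter_mem y).2 (rfl : v ∈ S), hOU hy.1⟩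
  have hopen : IsOpen (O ∩ {y | ⟪y, v -ᵥ w⟫ ≠ 0}) :=
    hO.inter (isOpen_ne_fun (by fun_prop) continuous_const)
  have hne := (dense_setOf_inner_ne_zero (vsub_ne_zero.2 hvw)).inter_open_nonempty O hO ⟨f, hfO⟩
  rw [AffineSubspace.affineSpan_eq_top_iff_vectorSpan_eq_top_of_nonempty ℝ V P ⟨v, hv⟩]
  exact Submodule.eq_top_of_nonempty_interior' _ (hne.mono (interior_maximal hsub hopen))

theorem infinite_sphere_inter_of_mem_nhds {E : Type*} [NormedAddCommGroup E] [NormedSpace ℝ E]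
    (hE : 1 < Module.rank ℝ E) {v w : E} (hvw : v ≠ w) {U : Set E} (hU : U ∈ 𝓝 v) :
    (Metric.sphere w (dist v w) ∩ U).Infinite := by
  have hsphere : (Metric.sphere w (dist v w)).Nontrivial := by
    refine ⟨v, rfl, AffineIsometryEquiv.pointReflection ℝ w v, ?_, fun h => hvw ?_⟩
    · rw [Metric.mem_sphere, AffineIsometryEquiv.dist_pointReflection_fixed]
    · exact AffineIsometryEquiv.pointReflection_fixed_iff.1 h.symm
  have hacc := (isPreconnected_sphere hE w (dist v w)).preperfect_of_nontrivial hsphere v rfl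
  rw [Set.inter_comm]
  exact Set.Infinite.of_accPt (hacc.nhds_inter hU)

end Sphere

section Graph

variable {d n : ℕ}

local notation "𝔼" => EuclideanSpace ℝ (Fin d)

theorem Polytope.finite_vertices (P : Polytope d) : P.vertices.Finite := by
  obtain ⟨S, hS⟩ := P.isHull
  rw [Polytope.vertices, hS]
  exact S.finite_toSet.subset extremePoints_convexHull_subset

theorem Polytope.convex (P : Polytope d) : Convex ℝ P.carrier := by
  obtain ⟨S, hS⟩ := P.isHull
  exact hS ▸ convex_convexHull ℝ _

theorem Polytope.isCompact (P : Polytope d) : IsCompact P.carrier := by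
  obtain ⟨S, hS⟩ := P.isHull
  exact hS ▸ S.finite_toSet.isCompact_convexHull ℝ

theorem Polytope.convexHull_vertices (P : Polytope d) : convexHull ℝ P.vertices = P.carrier := by
  rw [← (P.finite_vertices.isClosed_convexHull ℝ).closure_eq, Polytope.vertices,
    closure_convexHull_extremePoints P.isCompact P.convex]

theorem Polytope.vertices_injective : Function.Injective (Polytope.vertices (d := d)) := by
  intro P Q h
  have hcarrier : P.carrier = Q.carrier := by
    rw [← P.convexHull_vertices, h, Q.convexHull_vertices]
  cases P
  congr

theorem Polytope.convexIndependent_vertices (P : Polytope d) :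
    ConvexIndependent ℝ ((↑) : P.vertices → 𝔼) :=
  P.convex.convexIndependent_extremePoints

theorem Polytope.affineSpan_vertices (P : Polytope d) : affineSpan ℝ P.vertices = ⊤ := by
  rw [← affineSpan_convexHull, P.convexHull_vertices, P.fullDim]

/-- The polytope spanned by a finite set of points whose affine span is the whole space; the points
need not be its vertices. -/
def Polytope.hull (s : Set 𝔼) (hs : s.Finite) (ht : affineSpan ℝ s = ⊤) : Polytope d where
  carrier := convexHull ℝ s
  isHull := ⟨hs.toFinset, by rw [hs.coe_toFinset]⟩
  fullDim := by rwa [affineSpan_convexHull]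

theorem Polytope.vertices_hull {s : Set 𝔼} (hs : s.Finite) (ht : affineSpan ℝ s = ⊤)
    (hc : ConvexIndependent ℝ ((↑) : s → 𝔼)) : (Polytope.hull s hs ht).vertices = s :=
  extremePoints_convexHull_of_convexIndependent hs hc

theorem isInsertionMove_iff_covBy {P Q : Polytope d} :
    IsInsertionMove P Q ↔ P.vertices ⋖ Q.vertices := by
  rw [Set.covBy_iff_exists_insert]
  constructor
  · rintro ⟨x, ⟨hx, hext⟩, hQ⟩
    refine ⟨x, fun h => hx (extremePoints_subset h), ?_⟩
    rw [← Set.union_singleton, ← hext, ← hQ, Polytope.vertices]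
  · rintro ⟨x, hx, h⟩
    have hcarrier : Q.carrier = convexHull ℝ (P.carrier ∪ {x}) := by
      rw [← P.convexHull_vertices, ← Q.convexHull_vertices, ← h, convexHull_convexHull_union_left,
        Set.union_singleton]
    refine ⟨x, ⟨fun hxP => hx ?_, ?_⟩, hcarrier⟩
    · rw [← P.convexHull_vertices] at hxP
      exact convexIndependent_set_iff_inter_convexHull_subset.1 Q.convexIndependent_vertices _
        (h ▸ Set.subset_insert x _) ⟨h ▸ Set.mem_insert x _, hxP⟩
    · rw [← hcarrier, Set.union_singleton, h, Polytope.vertices]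

theorem isDeletionMove_iff_covBy {P Q : Polytope d} :
    IsDeletionMove P Q ↔ Q.vertices ⋖ P.vertices := by
  constructor
  · rintro ⟨v, ⟨hv, -⟩, hQ⟩
    have hQP : Q.vertices = P.vertices \ {v} := by
      rw [Polytope.vertices, hQ]
      exact extremePoints_convexHull_of_convexIndependent P.finite_vertices.sdiff
        (P.convexIndependent_vertices.mono Set.sdiff_subset)
    exact hQP ▸ Set.sdiff_singleton_covBy hv
  · intro h
    obtain ⟨v, hv, hP⟩ := Set.covBy_iff_exists_insert.1 h
    have hQ : P.vertices \ {v} = Q.vertices := by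
      rw [← hP, Set.insert_sdiff_self_of_notMem hv]
    refine ⟨v, ⟨hP ▸ Set.mem_insert v _, ?_⟩, ?_⟩
    · rw [hQ, Q.convexHull_vertices, Q.fullDim]
    · rw [hQ, Q.convexHull_vertices]

theorem gamma_adj_iff_covBy {P Q : Polytope d} :
    (Gamma d).Adj P Q ↔ P.vertices ⋖ Q.vertices ∨ Q.vertices ⋖ P.vertices := by
  simp only [Gamma, SimpleGraph.fromRel_adj, isInsertionMove_iff_covBy, isDeletionMove_iff_covBy]
  constructor
  · tauto
  · rintro (h | h)
    · exact ⟨fun hPQ => h.ne (congrArg _ hPQ), .inl (.inl h)⟩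
    · exact ⟨fun hPQ => h.ne (congrArg _ hPQ.symm), .inl (.inr h)⟩

theorem edist_le_one_of_covBy {P Q : level d n} (h : P.1.vertices ⋖ Q.1.vertices) :
    (GammaLevel d n).edist P Q ≤ 1 :=
  SimpleGraph.edist_le_one_iff_adj_or_eq.2
    (.inl (SimpleGraph.induce_adj.2 (gamma_adj_iff_covBy.2 (.inl h))))

theorem edist_le_two_of_covBy_of_covBy {P Q R : level d n} (hP : P.1.vertices ⋖ R.1.vertices)
    (hQ : Q.1.vertices ⋖ R.1.vertices) : (GammaLevel d n).edist P Q ≤ 2 := by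
  have hPR := edist_le_one_of_covBy hP
  have hRQ := edist_le_one_of_covBy hQ
  rw [SimpleGraph.edist_comm] at hRQ
  exact SimpleGraph.edist_triangle.trans ((add_le_add hPR hRQ).trans_eq one_add_one_eq_two)

end Graph

section Exchange

variable {k V A : Type*} [DivisionRing k] [AddCommGroup V] [Module k V] [AddTorsor V A]

theorem mem_affineSpan_insert_exchange {s : Set A} {x y : A} (hx : x ∈ affineSpan k (insert y s))
    (hxs : x ∉ affineSpan k s) : y ∈ affineSpan k (insert x s) := by
  rcases s.eq_empty_or_nonempty with rfl | ⟨p, hp⟩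
  · simp_all
  have hmem : ∀ {t : Set A}, p ∈ t → ∀ z,
      z ∈ affineSpan k t ↔ z -ᵥ p ∈ Submodule.span k ((· -ᵥ p) '' t) := fun ht z => by
    rw [← AffineSubspace.vsub_right_mem_direction_iff_mem (mem_affineSpan k ht),
      direction_affineSpan, vectorSpan_eq_span_vsub_set_right k ht]
  rw [hmem (Set.mem_insert_of_mem _ hp), Set.image_insert_eq] at hx ⊢
  rw [hmem hp] at hxs
  exact mem_span_insert_exchange hx hxs

theorem affineSpan_insert_eq_top_of_notMem {s : Set A} {x y : A}
    (hy : affineSpan k (insert y s) = ⊤) (hx : x ∉ affineSpan k s) :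
    affineSpan k (insert x s) = ⊤ := by
  have hy' : y ∈ affineSpan k (insert x s) :=
    mem_affineSpan_insert_exchange (hy ▸ AffineSubspace.mem_top k V x) hx
  rw [eq_top_iff, ← hy, affineSpan_le]
  exact Set.insert_subset hy' ((Set.subset_insert x s).trans (subset_affineSpan k _))

theorem exists_affineSpan_exchange_eq_top {s K : Set A} (hs : s.Finite)
    (hspan : affineSpan k s = ⊤) (hK : affineSpan k K = ⊤) (hcard : s.encard ≤ K.encard) {y : A}
    (hy : y ∈ s \ K) : ∃ x ∈ K \ s, affineSpan k (insert x (s \ {y})) = ⊤ := by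
  by_cases htop : affineSpan k (s \ {y}) = ⊤
  · obtain ⟨x, hx⟩ : (K \ s).Nonempty := by
      rw [Set.sdiff_nonempty]
      intro hKs
      have hlt : K.encard < s.encard :=
        (hs.subset hKs).encard_lt_encard ⟨hKs, fun h => hy.2 (h hy.1)⟩
      exact hcard.not_gt hlt
    exact ⟨x, hx, top_unique (htop.ge.trans (affineSpan_mono k (Set.subset_insert _ _)))⟩
  · obtain ⟨x, hxK, hx⟩ : ∃ x ∈ K, x ∉ affineSpan k (s \ {y}) := by
      by_contra! hcon
      exact htop (top_unique (hK.ge.trans (affineSpan_le.2 hcon)))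
    refine ⟨x, ⟨hxK, fun hxs => hx (mem_affineSpan k ⟨hxs, ?_⟩)⟩,
      affineSpan_insert_eq_top_of_notMem (y := y) ?_ hx⟩
    · exact fun hxy => hy.2 (hxy ▸ hxK)
    · rwa [Set.insert_sdiff_singleton, Set.insert_eq_of_mem hy.1]

variable {d n : ℕ}

local notation "𝔼" => EuclideanSpace ℝ (Fin d)

theorem exists_vertices_exchange {P : level d n} (hP : P.1.numVertices = n) {x y : 𝔼}
    (hx : x ∉ P.1.vertices) (hy : y ∈ P.1.vertices)
    (hc : ConvexIndependent ℝ ((↑) : (insert x P.1.vertices : Set 𝔼) → 𝔼))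
    (hspan : affineSpan ℝ (insert x (P.1.vertices \ {y})) = ⊤) :
    ∃ Q : level d n, Q.1.vertices = insert x (P.1.vertices \ {y}) ∧
      (GammaLevel d n).edist P Q ≤ 2 := by
  have hfin := P.1.finite_vertices
  have hsub : insert x (P.1.vertices \ {y}) ⊆ insert x P.1.vertices :=
    Set.insert_subset_insert Set.sdiff_subset
  have hspanR : affineSpan ℝ (insert x P.1.vertices) = ⊤ :=
    top_unique (hspan.ge.trans (affineSpan_mono ℝ hsub))
  have hQ := Polytope.vertices_hull (hfin.sdiff.insert x) hspan (hc.mono hsub)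
  have hR := Polytope.vertices_hull (hfin.insert x) hspanR hc
  set Q := Polytope.hull _ _ hspan
  set R := Polytope.hull _ _ hspanR
  have hQn : Q ∈ level d n := by
    left
    rw [Polytope.numVertices, hQ, Set.ncard_exchange hx hy, ← Polytope.numVertices, hP]
  have hRn : R ∈ level d n := by
    right
    rw [Polytope.numVertices, hR, Set.ncard_insert_of_notMem hx hfin, ← Polytope.numVertices, hP]
  refine ⟨⟨Q, hQn⟩, hQ, edist_le_two_of_covBy_of_covBy (R := ⟨R, hRn⟩) ?_ ?_⟩
  · exact hR ▸ Set.covBy_insert hx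
  · have hyx : y ≠ x := fun h => hx (h ▸ hy)
    rw [hQ, hR, Set.insert_sdiff_singleton_comm hyx.symm]
    exact Set.sdiff_singleton_covBy (Set.mem_insert_of_mem x hy)

theorem exists_vertices_subset_edist_le {C K : Set 𝔼} (hC : ConvexIndependent ℝ ((↑) : C → 𝔼))
    (hKC : K ⊆ C) (hK : affineSpan ℝ K = ⊤) (hcard : n ≤ K.encard) (P : level d n)
    (hP : P.1.numVertices = n) (hPC : P.1.vertices ⊆ C) :
    ∃ Q : level d n, Q.1.numVertices = n ∧ Q.1.vertices ⊆ K ∧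
      (GammaLevel d n).edist P Q ≤ (2 * (P.1.vertices \ K).ncard : ℕ) := by
  induction hm : (P.1.vertices \ K).ncard generalizing P with
  | zero =>
    rw [Set.ncard_eq_zero P.1.finite_vertices.sdiff, Set.sdiff_eq_empty] at hm
    exact ⟨P, hP, hm, by simp⟩
  | succ m ih =>
    obtain ⟨y, hy⟩ := Set.nonempty_of_ncard_ne_zero (hm.trans_ne m.succ_ne_zero)
    have hcard' : P.1.vertices.encard ≤ K.encard := by
      rwa [← P.1.finite_vertices.cast_ncard_eq, ← Polytope.numVertices, hP]
    obtain ⟨x, ⟨hxK, hxP⟩, hspan⟩ := exists_affineSpan_exchange_eq_top P.1.finite_vertices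
      P.1.affineSpan_vertices hK hcard' hy
    obtain ⟨Q, hQ, hPQ⟩ := exists_vertices_exchange hP hxP hy.1
      (hC.mono (Set.insert_subset (hKC hxK) hPC)) hspan
    have hQn : Q.1.numVertices = n := by
      rw [Polytope.numVertices, hQ, Set.ncard_exchange hxP hy.1, ← Polytope.numVertices, hP]
    have hQK : (Q.1.vertices \ K).ncard = m := by
      have hsdiff : Q.1.vertices \ K = (P.1.vertices \ K) \ {y} := by
        rw [hQ, Set.insert_sdiff_of_mem _ hxK, sdiff_right_comm]
      rw [hsdiff, Set.ncard_sdiff_singleton_of_mem hy, hm, Nat.add_sub_cancel]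
    obtain ⟨Z, hZn, hZK, hQZ⟩ := ih Q hQn
      (hQ ▸ Set.insert_subset (hKC hxK) (Set.sdiff_subset.trans hPC)) hQK
    refine ⟨Z, hZn, hZK, ?_⟩
    calc (GammaLevel d n).edist P Z
        ≤ (GammaLevel d n).edist P Q + (GammaLevel d n).edist Q Z := SimpleGraph.edist_triangle
      _ ≤ 2 + (2 * m : ℕ) := add_le_add hPQ hQZ
      _ = (2 * (m + 1) : ℕ) := by
          push_cast
          ring

end Exchange

section UpperBound

variable {d n : ℕ}

local notation "𝔼" => EuclideanSpace ℝ (Fin d)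

theorem edist_le_add_add {α : Type*} {G : SimpleGraph α} {a b c e : α} {k l m : ℕ∞}
    (hab : G.edist a b ≤ k) (hbc : G.edist b c ≤ l) (hce : G.edist c e ≤ m) :
    G.edist a e ≤ k + l + m :=
  SimpleGraph.edist_triangle.trans
    (add_le_add (SimpleGraph.edist_triangle.trans (add_le_add hab hbc)) hce)

theorem exists_vertices_subset_sphere_inter_edist_le (hd : 2 ≤ d) (P : level d n)
    (hP : P.1.numVertices = n) {v w : 𝔼} (hv : v ∈ P.1.vertices) (hvw : v ≠ w)
    (hPw : P.1.vertices ⊆ Metric.closedBall w (dist v w)) {N : Set 𝔼} (hN : N ∈ 𝓝 v) :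
    ∃ Q : level d n, Q.1.numVertices = n ∧ Q.1.vertices ⊆ Metric.sphere w (dist v w) ∩ N ∧
      (GammaLevel d n).edist P Q ≤ (2 * (n - 1) : ℕ) := by
  have hrank : 1 < Module.rank ℝ 𝔼 := by
    rw [← Module.finrank_eq_rank, finrank_euclideanSpace_fin]
    exact_mod_cast hd
  obtain ⟨U, hU, hUN, hC⟩ := ((Filter.eventually_smallSets_subset.2 hN).and
    (eventually_smallSets_convexIndependent_union_sphere P.1.finite_vertices
      P.1.convexIndependent_vertices hv hvw hPw)).exists_mem_of_smallSets
  have hinf := infinite_sphere_inter_of_mem_nhds hrank hvw hU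
  obtain ⟨Q, hQn, hQ, hPQ⟩ := exists_vertices_subset_edist_le hC Set.subset_union_right
    (affineSpan_sphere_inter_of_mem_nhds hrank hvw hU) (hinf.encard_eq ▸ le_top) P hP
    Set.subset_union_left
  refine ⟨Q, hQn, hQ.trans (Set.inter_subset_inter_right _ hUN), hPQ.trans ?_⟩
  have hsub : P.1.vertices \ (Metric.sphere w (dist v w) ∩ U) ⊆ P.1.vertices \ {v} :=
    Set.sdiff_subset_sdiff_right (Set.singleton_subset_iff.2 ⟨rfl, mem_of_mem_nhds hU⟩)
  have hcard := Set.ncard_le_ncard hsub P.1.finite_vertices.sdiff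
  rw [Set.ncard_sdiff_singleton_of_mem hv, ← Polytope.numVertices, hP] at hcard
  exact_mod_cast Nat.mul_le_mul_left 2 hcard

theorem edist_le_of_convexIndependent_union {P Q : level d n}
    (hP : P.1.numVertices = n) (hQ : Q.1.numVertices = n)
    (hC : ConvexIndependent ℝ ((↑) : (P.1.vertices ∪ Q.1.vertices : Set 𝔼) → 𝔼)) :
    (GammaLevel d n).edist P Q ≤ (2 * n : ℕ) := by
  have hcard : n ≤ Q.1.vertices.encard := by
    rw [← Q.1.finite_vertices.cast_ncard_eq, ← Polytope.numVertices, hQ]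
  obtain ⟨R, hRn, hRQ, hPR⟩ := exists_vertices_subset_edist_le hC Set.subset_union_right
    Q.1.affineSpan_vertices hcard P hP Set.subset_union_left
  obtain rfl : R = Q := by
    refine Subtype.ext (Polytope.vertices_injective
      (Set.eq_of_subset_of_ncard_le hRQ ?_ Q.1.finite_vertices))
    rw [← Polytope.numVertices, ← Polytope.numVertices, hQ, hRn]
  refine hPR.trans (Nat.cast_le.2 (Nat.mul_le_mul_left 2 ?_))
  exact (Set.ncard_le_ncard Set.sdiff_subset P.1.finite_vertices).trans_eq hP

theorem exists_ne_forall_dist_le {α : Type*} [MetricSpace α] {s t : Set α} (hs : s.Finite)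
    (ht : t.Finite) (hsn : s.Nontrivial) (htn : t.Nonempty) :
    ∃ v ∈ s, ∃ w ∈ t, v ≠ w ∧ ∀ x ∈ s, ∀ y ∈ t, dist x y ≤ dist v w := by
  obtain ⟨⟨v, w⟩, ⟨hv, hw⟩, hmax⟩ := Set.exists_max_image (s ×ˢ t) (fun p => dist p.1 p.2)
    (hs.prod ht) (hsn.nonempty.prod htn)
  obtain ⟨x, hx, hxw⟩ := hsn.exists_ne w
  have hpos := (dist_pos.2 hxw).trans_le (hmax (x, w) ⟨hx, hw⟩)
  exact ⟨v, hv, w, hw, dist_pos.1 hpos, fun x hx y hy => hmax (x, y) ⟨hx, hy⟩⟩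

theorem edist_le_of_numVertices_eq (hd : 2 ≤ d) (hn : d + 1 ≤ n) (P Q : level d n)
    (hP : P.1.numVertices = n) (hQ : Q.1.numVertices = n) :
    (GammaLevel d n).edist P Q ≤ (6 * n - 4 : ℕ) := by
  have hPn : P.1.vertices.Nontrivial :=
    (Set.one_lt_ncard_iff_nontrivial_and_finite.1 (show 1 < P.1.numVertices by lia)).1
  have hQn : Q.1.vertices.Nonempty :=
    Set.nonempty_of_ncard_ne_zero (show Q.1.numVertices ≠ 0 by lia)
  obtain ⟨v, hv, w, hw, hvw, hmax⟩ := exists_ne_forall_dist_le P.1.finite_vertices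
    Q.1.finite_vertices hPn hQn
  obtain ⟨P', hP'n, hP', hPP'⟩ := exists_vertices_subset_sphere_inter_edist_le hd P hP hv hvw
    (fun x hx => hmax x hx w hw) (Metric.closedBall_mem_nhds v (dist_pos.2 hvw))
  have hQv : Q.1.vertices ⊆ Metric.closedBall v (dist w v) := fun y hy => by
    rw [Metric.mem_closedBall', dist_comm w v]
    exact hmax v hv y hy
  obtain ⟨Q', hQ'n, hQ', hQQ'⟩ := exists_vertices_subset_sphere_inter_edist_le hd Q hQ hw
    hvw.symm hQv (Metric.closedBall_mem_nhds w (dist_pos.2 hvw))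
  have hPQ' := edist_le_of_convexIndependent_union hP'n hQ'n
    (convexIndependent_union_of_subset_sphere (dist_ne_zero.2 hvw) hP' (dist_comm w v ▸ hQ'))
  rw [SimpleGraph.edist_comm] at hQQ'
  refine (edist_le_add_add hPP' hPQ' hQQ').trans_eq ?_
  norm_cast
  lia

theorem exists_mem_affineSpan_sdiff_singleton_eq_top {k V A : Type*} [DivisionRing k]
    [AddCommGroup V] [Module k V] [AddTorsor V A] [FiniteDimensional k V] {s : Set A}
    (hs : s.Finite) (hspan : affineSpan k s = ⊤) (hcard : Module.finrank k V + 1 < s.ncard) :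
    ∃ v ∈ s, affineSpan k (s \ {v}) = ⊤ := by
  obtain ⟨t, hts, htspan, hti⟩ := exists_affineIndependent k V s
  have : Fintype t := (hs.subset hts).fintype
  have htcard : t.ncard < s.ncard := by
    refine lt_of_le_of_lt ?_ hcard
    rw [← Nat.card_coe_set_eq, Nat.card_eq_fintype_card]
    exact hti.card_le_finrank_succ.trans (Nat.add_le_add_right (Submodule.finrank_le _) 1)
  obtain ⟨v, hvs, hvt⟩ := Set.exists_mem_notMem_of_ncard_lt_ncard htcard (hs.subset hts)
  refine ⟨v, hvs, top_unique ?_⟩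
  rw [← hspan, ← htspan]
  exact affineSpan_mono k (Set.subset_sdiff_singleton hts hvt)

theorem exists_numVertices_eq_edist_le_one (hn : d + 1 ≤ n) (P : level d n) :
    ∃ Q : level d n, Q.1.numVertices = n ∧ (GammaLevel d n).edist P Q ≤ 1 := by
  rcases P.2 with hP | hP
  · exact ⟨P, hP, by simp⟩
  obtain ⟨v, hv, hspan⟩ := exists_mem_affineSpan_sdiff_singleton_eq_top P.1.finite_vertices
    P.1.affineSpan_vertices
    (by rw [finrank_euclideanSpace_fin, ← Polytope.numVertices, hP]; lia)
  have hQ := Polytope.vertices_hull P.1.finite_vertices.sdiff hspan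
    (P.1.convexIndependent_vertices.mono Set.sdiff_subset)
  set Q := Polytope.hull _ _ hspan
  have hQn : Q.numVertices = n := by
    rw [Polytope.numVertices, hQ, Set.ncard_sdiff_singleton_of_mem hv, ← Polytope.numVertices, hP,
      Nat.add_sub_cancel]
  refine ⟨⟨Q, .inl hQn⟩, hQn, ?_⟩
  rw [SimpleGraph.edist_comm]
  exact edist_le_one_of_covBy (hQ ▸ Set.sdiff_singleton_covBy hv)

theorem edist_le (hd : 2 ≤ d) (hn : d + 1 ≤ n) (P Q : level d n) :
    (GammaLevel d n).edist P Q ≤ (6 * n - 2 : ℕ) := by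
  obtain ⟨P', hP', hPP'⟩ := exists_numVertices_eq_edist_le_one hn P
  obtain ⟨Q', hQ', hQQ'⟩ := exists_numVertices_eq_edist_le_one hn Q
  have hPQ' := edist_le_of_numVertices_eq hd hn P' Q' hP' hQ'
  rw [SimpleGraph.edist_comm] at hQQ'
  refine (edist_le_add_add hPP' hPQ' hQQ').trans_eq ?_
  norm_cast
  lia

end UpperBound

section Pyramid

variable {E κ : Type*} [AddCommGroup E] [Module ℝ E]

/-- The point with coordinates `(t, 1 + t ^ 2)` in the plane of the first two vectors of `e`. -/
def parabolaPoint (e : Fin 2 ⊕ κ → E) (t : ℝ) : E :=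
  t • e (.inl 0) + (1 + t ^ 2) • e (.inl 1)

/-- The vertices of an iterated pyramid whose base is inscribed in a parabola, with parameters in
`S`, and whose apices are the vectors of `e` transverse to the plane of the parabola. -/
def pyramidVertices (e : Fin 2 ⊕ κ → E) (S : Set ℝ) : Set E :=
  parabolaPoint e '' S ∪ Set.range (e ∘ Sum.inr)

theorem finite_pyramidVertices [Finite κ] (e : Fin 2 ⊕ κ → E) {S : Set ℝ} (hS : S.Finite) :
    (pyramidVertices e S).Finite :=
  (hS.image _).union (Set.finite_range _)

@[simp]
theorem repr_parabolaPoint_inl_zero (e : Module.Basis (Fin 2 ⊕ κ) ℝ E) (t : ℝ) :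
    e.repr (parabolaPoint e t) (.inl 0) = t := by
  simp [parabolaPoint]

@[simp]
theorem repr_parabolaPoint_inl_one (e : Module.Basis (Fin 2 ⊕ κ) ℝ E) (t : ℝ) :
    e.repr (parabolaPoint e t) (.inl 1) = 1 + t ^ 2 := by
  simp [parabolaPoint]

@[simp]
theorem repr_parabolaPoint_inr (e : Module.Basis (Fin 2 ⊕ κ) ℝ E) (t : ℝ) (j : κ) :
    e.repr (parabolaPoint e t) (.inr j) = 0 := by
  simp [parabolaPoint]

theorem parabolaPoint_injective (e : Module.Basis (Fin 2 ⊕ κ) ℝ E) :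
    Function.Injective (parabolaPoint e) := fun s t h => by
  simpa using congrArg (e.repr · (.inl 0)) h

theorem repr_inl_one_nonneg_of_mem_pyramidVertices (e : Module.Basis (Fin 2 ⊕ κ) ℝ E) {S : Set ℝ}
    {x : E} (hx : x ∈ pyramidVertices e S) : 0 ≤ e.repr x (.inl 1) := by
  rcases hx with ⟨t, -, rfl⟩ | ⟨j, rfl⟩
  · rw [repr_parabolaPoint_inl_one]
    positivity
  · simp

theorem neg_parabolaPoint_notMem_pyramidVertices (e : Module.Basis (Fin 2 ⊕ κ) ℝ E) (S : Set ℝ)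
    (t : ℝ) : -parabolaPoint e t ∉ pyramidVertices e S := by
  intro h
  have hnonneg := repr_inl_one_nonneg_of_mem_pyramidVertices e h
  rw [map_neg, Finsupp.neg_apply, repr_parabolaPoint_inl_one] at hnonneg
  linarith [sq_nonneg t]

theorem convexIndependent_pyramidVertices (e : Module.Basis (Fin 2 ⊕ κ) ℝ E) (S : Set ℝ) :
    ConvexIndependent ℝ ((↑) : pyramidVertices e S → E) := by
  refine convexIndependent_of_forall_exists_lt ?_
  rintro _ (⟨t, -, rfl⟩ | ⟨j, rfl⟩)
  · let f : E →ₗ[ℝ] ℝ := e.constr ℝ (Sum.elim ![-2 * t, 1] fun _ => 2)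
    have hf : ∀ s, f (parabolaPoint e s) = (s - t) ^ 2 + (1 - t ^ 2) := fun s => by
      simp only [f, parabolaPoint, map_add, map_smul, Module.Basis.constr_basis, Sum.elim_inl,
        Matrix.cons_val_zero, Matrix.cons_val_one, smul_eq_mul]
      ring
    refine ⟨f, ?_⟩
    rintro _ (⟨s, -, rfl⟩ | ⟨j, rfl⟩) hne
    · have hst : 0 < (s - t) ^ 2 := pow_two_pos_of_ne_zero (sub_ne_zero.2 fun h => hne (h ▸ rfl))
      rw [hf, hf]
      linarith
    · have hfj : f (e (.inr j)) = 2 := e.constr_basis ℝ _ _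
      rw [hf, Function.comp_apply, hfj]
      linarith [sq_nonneg t]
  · refine ⟨-e.coord (.inr j), ?_⟩
    rintro _ (⟨s, -, rfl⟩ | ⟨i, rfl⟩) hne
    · simp
    · have hij : i ≠ j := fun h => hne (h ▸ rfl)
      simp [hij]

theorem ncard_pyramidVertices (e : Module.Basis (Fin 2 ⊕ κ) ℝ E) [Fintype κ] {S : Set ℝ}
    (hS : S.Finite) : (pyramidVertices e S).ncard = S.ncard + Fintype.card κ := by
  have hdisj : Disjoint (parabolaPoint e '' S) (Set.range (e ∘ Sum.inr)) := by
    rw [Set.disjoint_left]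
    rintro _ ⟨t, -, rfl⟩ ⟨j, hj⟩
    simpa using congrArg (e.repr · (.inr j)) hj
  rw [pyramidVertices, Set.ncard_union_eq hdisj (hS.image _) (Set.finite_range _),
    Set.ncard_image_of_injective _ (parabolaPoint_injective e), ← Set.image_univ,
    Set.ncard_image_of_injective _ (e.injective.comp Sum.inr_injective), Set.ncard_univ,
    Nat.card_eq_fintype_card]

theorem chord_direction_mem_vectorSpan (e : Fin 2 ⊕ κ → E) {S : Set ℝ} {s t : ℝ} (hs : s ∈ S)
    (ht : t ∈ S) (hst : s ≠ t) :
    e (.inl 0) + (s + t) • e (.inl 1) ∈ vectorSpan ℝ (parabolaPoint e '' S) := by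
  have hmem : parabolaPoint e s -ᵥ parabolaPoint e t ∈ vectorSpan ℝ (parabolaPoint e '' S) :=
    vsub_mem_vectorSpan ℝ (Set.mem_image_of_mem _ hs) (Set.mem_image_of_mem _ ht)
  have hchord : parabolaPoint e s -ᵥ parabolaPoint e t =
      (s - t) • (e (.inl 0) + (s + t) • e (.inl 1)) := by
    simp only [parabolaPoint, vsub_eq_sub]
    module
  rw [hchord] at hmem
  exact (Submodule.smul_mem_iff _ (sub_ne_zero.2 hst)).1 hmem

theorem apply_inl_mem_vectorSpan (e : Fin 2 ⊕ κ → E) {S : Set ℝ} (hS : 2 < S.ncard) (i : Fin 2) :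
    e (.inl i) ∈ vectorSpan ℝ (parabolaPoint e '' S) := by
  obtain ⟨r, s, t, hr, hs, ht, hrs, hrt, hst⟩ :=
    (Set.two_lt_ncard_iff (Set.finite_of_ncard_pos (by lia))).1 hS
  have hsr := chord_direction_mem_vectorSpan e hs hr hrs.symm
  have htr := chord_direction_mem_vectorSpan e ht hr hrt.symm
  have hone : e (.inl 1) ∈ vectorSpan ℝ (parabolaPoint e '' S) := by
    refine (Submodule.smul_mem_iff _ (sub_ne_zero.2 hst)).1 ?_
    convert Submodule.sub_mem _ hsr htr using 1
    module
  fin_cases i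
  · exact (Submodule.add_mem_iff_left _ (Submodule.smul_mem _ _ hone)).1 hsr
  · exact hone

theorem affineSpan_pyramidVertices (e : Module.Basis (Fin 2 ⊕ κ) ℝ E) {S : Set ℝ}
    (hS : 2 < S.ncard) : affineSpan ℝ (pyramidVertices e S) = ⊤ := by
  obtain ⟨t, ht⟩ := Set.nonempty_of_ncard_ne_zero (show S.ncard ≠ 0 by lia)
  have htS : parabolaPoint e t ∈ pyramidVertices e S := .inl (Set.mem_image_of_mem _ ht)
  have hinl : ∀ i, e (.inl i) ∈ vectorSpan ℝ (pyramidVertices e S) := fun i =>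
    vectorSpan_mono ℝ Set.subset_union_left (apply_inl_mem_vectorSpan e hS i)
  have hpt : parabolaPoint e t ∈ vectorSpan ℝ (pyramidVertices e S) :=
    Submodule.add_mem _ (Submodule.smul_mem _ _ (hinl 0)) (Submodule.smul_mem _ _ (hinl 1))
  rw [AffineSubspace.affineSpan_eq_top_iff_vectorSpan_eq_top_of_nonempty ℝ E E ⟨_, htS⟩, eq_top_iff,
    ← e.span_eq, Submodule.span_le]
  rintro _ ⟨i | j, rfl⟩
  · exact hinl i
  · exact (Submodule.sub_mem_iff_left _ hpt).1 (vsub_mem_vectorSpan ℝ (.inr ⟨j, rfl⟩) htS)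

end Pyramid

section Counting

theorem encard_le_two_of_forall_lt {α : Type*} [LinearOrder α] {s : Set α}
    (h : ∀ i ∈ s, ∀ j ∈ s, ∀ k ∈ s, i < j → ¬j < k) : s.encard ≤ 2 := by
  by_contra! hs
  obtain ⟨t, hts, ht⟩ := Set.exists_subset_encard_eq (Order.add_one_le_of_lt hs)
  obtain ⟨x, y, z, hxy, hxz, hyz, rfl⟩ := Set.encard_eq_three.1 ht
  simp only [Set.insert_subset_iff, Set.singleton_subset_iff] at hts
  rcases hxy.lt_or_gt with _ | _ <;> rcases hxz.lt_or_gt with _ | _ <;>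
    rcases hyz.lt_or_gt with _ | _ <;> grind

theorem sum_le_sum_of_involutive {κ : Type*} [Fintype κ] {σ : κ → κ} (hσ : σ.Involutive)
    {f g : κ → ℕ} (h : ∀ j, f j + f (σ j) ≤ 2 * g j) : ∑ j, f j ≤ ∑ j, g j := by
  have hsum : ∑ j, f (σ j) = ∑ j, f j := Equiv.sum_comp hσ.toPerm f
  have hle := Finset.sum_le_sum fun j (_ : j ∈ Finset.univ) => h j
  rw [Finset.sum_add_distrib, hsum, ← Finset.mul_sum] at hle
  lia

variable {E : Type*} [AddCommGroup E] [Module ℝ E]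

theorem encard_inter_preimage_le_two {α : Type*} [LinearOrder α] {W Z : Set E}
    (hW : ConvexIndependent ℝ ((↑) : W → E)) (hZW : Z ⊆ W) {f : α → E} {T : Set α}
    (hf : Set.InjOn f T) (hfZ : ∀ t ∈ T, f t ∉ Z)
    (h : ∀ i ∈ T, ∀ j ∈ T, ∀ k ∈ T, i < j → j < k →
      f j ∈ convexHull ℝ (insert (f i) (insert (f k) Z))) :
    (T ∩ f ⁻¹' W).encard ≤ 2 := by
  refine encard_le_two_of_forall_lt ?_
  rintro i ⟨hi, hiW⟩ j ⟨hj, hjW⟩ k ⟨hk, hkW⟩ hij hjk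
  rcases convexIndependent_set_iff_inter_convexHull_subset.1 hW _
    (Set.insert_subset hiW (Set.insert_subset hkW hZW)) ⟨hjW, h i hi j hj k hk hij hjk⟩ with
    hji | hjk' | hjZ
  · exact hij.ne' (hf hj hi hji)
  · exact hjk.ne (hf hj hk hjk')
  · exact hfZ j hj hjZ

theorem encard_lineMap_preimage_le_two {W : Set E} (hW : ConvexIndependent ℝ ((↑) : W → E))
    {a b : E} (hab : a ≠ b) : (AffineMap.lineMap (k := ℝ) a b ⁻¹' W).encard ≤ 2 := by
  rw [← Set.univ_inter (AffineMap.lineMap a b ⁻¹' W)]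
  refine encard_inter_preimage_le_two hW (Set.empty_subset W)
    (AffineMap.lineMap_injective ℝ hab).injOn (fun _ _ => Set.notMem_empty _) ?_
  intro i _ j _ k _ hij hjk
  rw [insert_empty_eq, convexHull_pair, ← image_segment, segment_eq_Icc (hij.trans hjk).le]
  exact ⟨j, ⟨hij.le, hjk.le⟩, rfl⟩

open scoped Pointwise in
theorem mem_of_add_smul_eq_of_convex {C : Set E} (hC : Convex ℝ C) {x y z p : E} (hx : x ∈ C)
    (hy : y ∈ C) (hz : z ∈ C) {a b c : ℝ} (ha : 0 ≤ a) (hb : 0 ≤ b) (hc : 0 ≤ c)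
    (habc : a + b + c ≠ 0) (h : (a + b + c) • p = a • x + b • y + c • z) : p ∈ C := by
  rw [← Set.smul_mem_smul_set_iff₀ habc, h, hC.add_smul (add_nonneg ha hb) hc, hC.add_smul ha hb]
  exact Set.add_mem_add (Set.add_mem_add (Set.smul_mem_smul_set hx) (Set.smul_mem_smul_set hy))
    (Set.smul_mem_smul_set hz)

variable {κ : Type*}

theorem parabolaPoint_mem_convexHull (e : Fin 2 ⊕ κ → E) {i j k s : ℝ} (hi : 0 ≤ i) (hij : i < j)
    (hjk : j < k) (hk : k ≤ 1) (hs : 0 ≤ s) :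
    parabolaPoint e j ∈
      convexHull ℝ {parabolaPoint e i, parabolaPoint e k, -parabolaPoint e s} := by
  have hweight : ∀ a b : ℝ, 0 ≤ b → a ≤ 1 → b ≤ 1 → 0 ≤ 2 + 2 * s ^ 2 - (s + a) * (s + b) := by
    intro a b hb ha1 hb1
    have hle : (s + a) * (s + b) ≤ (s + 1) * (s + 1) := by gcongr
    linarith [sq_nonneg (s - 1)]
  have hpos : 0 < (j - i) * (k - j) * (k - i) := by
    have := sub_pos.2 hij
    have := sub_pos.2 hjk
    have := sub_pos.2 (hij.trans hjk)
    positivity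
  have hwi := mul_nonneg (sub_nonneg.2 hjk.le) (hweight j k (by linarith) (by linarith) hk)
  have hwk := mul_nonneg (sub_nonneg.2 hij.le)
    (hweight i j (by linarith) (by linarith) (by linarith))
  -- The weights are the doubled areas of the triangles spanned by `parabolaPoint e j` and two of
  -- the three other points.
  refine mem_of_add_smul_eq_of_convex (convex_convexHull ℝ _) (subset_convexHull ℝ _ (.inl rfl))
    (subset_convexHull ℝ _ (.inr (.inl rfl))) (subset_convexHull ℝ _ (.inr (.inr rfl)))
    hwi hwk hpos.le (by linarith) ?_
  simp only [parabolaPoint]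
  module

theorem encard_image_parabolaPoint_inter_le_two (e : Module.Basis (Fin 2 ⊕ κ) ℝ E) {W : Set E}
    (hW : ConvexIndependent ℝ ((↑) : W → E)) {S : Set ℝ} (hS : S ⊆ Set.Icc 0 1) {s : ℝ}
    (hs : 0 ≤ s) (hsW : -parabolaPoint e s ∈ W) : (parabolaPoint e '' S ∩ W).encard ≤ 2 := by
  rw [← Set.image_inter_preimage]
  refine (Set.encard_image_le _ _).trans (encard_inter_preimage_le_two hW
    (Set.singleton_subset_iff.2 hsW) (parabolaPoint_injective e).injOn ?_ ?_)
  · intro t ht h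
    exact neg_parabolaPoint_notMem_pyramidVertices e S s (h ▸ .inl (Set.mem_image_of_mem _ ht))
  · exact fun i hi j _ k hk hij hjk =>
      parabolaPoint_mem_convexHull e (hS hi).1 hij hjk (hS hk).2 hs

end Counting

section Opposite

variable {E κ : Type*} [AddCommGroup E] [Module ℝ E] {σ : κ → κ}

/-- The family obtained from `e` by reflecting the plane of the first two vectors about the origin,
and by moving each transverse vector along the line through the one that `σ` pairs with it (a
transverse vector fixed by `σ` stays in place). -/
def oppositeFamily (σ : κ → κ) (e : Fin 2 ⊕ κ → E) : Fin 2 ⊕ κ → E :=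
  Sum.elim (fun i => -e (.inl i)) fun j => (2 : ℝ) • e (.inr j) - e (.inr (σ j))

theorem parabolaPoint_oppositeFamily (σ : κ → κ) (e : Fin 2 ⊕ κ → E) (t : ℝ) :
    parabolaPoint (oppositeFamily σ e) t = -parabolaPoint e t := by
  simp only [parabolaPoint, oppositeFamily, Sum.elim_inl]
  module

theorem top_le_span_oppositeFamily (hσ : σ.Involutive) (e : Module.Basis (Fin 2 ⊕ κ) ℝ E) :
    ⊤ ≤ Submodule.span ℝ (Set.range (oppositeFamily σ e)) := by
  have hmem : ∀ i, oppositeFamily σ e i ∈ Submodule.span ℝ (Set.range (oppositeFamily σ e)) :=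
    fun i => Submodule.subset_span ⟨i, rfl⟩
  rw [← e.span_eq, Submodule.span_le]
  rintro _ ⟨i | j, rfl⟩
  · exact (Submodule.neg_mem_iff _).1 (hmem (.inl i))
  · refine (Submodule.smul_mem_iff _ (three_ne_zero (α := ℝ))).1 ?_
    convert Submodule.add_mem _ (Submodule.smul_mem _ (2 : ℝ) (hmem (.inr j)))
      (hmem (.inr (σ j))) using 1
    simp only [oppositeFamily, Sum.elim_inr, hσ j]
    module

/-- `oppositeFamily σ e` as a basis, when `e` is a basis and `σ` is an involution. -/
noncomputable def oppositeBasis [Fintype κ] (hσ : σ.Involutive)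
    (e : Module.Basis (Fin 2 ⊕ κ) ℝ E) : Module.Basis (Fin 2 ⊕ κ) ℝ E :=
  basisOfTopLeSpanOfCardEqFinrank (oppositeFamily σ e) (top_le_span_oppositeFamily hσ e)
    (Module.finrank_eq_card_basis e).symm

theorem coe_oppositeBasis [Fintype κ] (hσ : σ.Involutive) (e : Module.Basis (Fin 2 ⊕ κ) ℝ E) :
    ⇑(oppositeBasis hσ e) = oppositeFamily σ e :=
  coe_basisOfTopLeSpanOfCardEqFinrank _ _ _

theorem disjoint_pyramidVertices_oppositeFamily (e : Module.Basis (Fin 2 ⊕ κ) ℝ E) (S T : Set ℝ) :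
    Disjoint (pyramidVertices e S) (parabolaPoint (oppositeFamily σ e) '' T) := by
  rw [Set.disjoint_right]
  rintro _ ⟨t, -, rfl⟩
  rw [parabolaPoint_oppositeFamily]
  exact neg_parabolaPoint_notMem_pyramidVertices e S t

variable {W : Set E}

open Classical in
theorem sum_ite_mem_le_two (hσ : σ.Involutive) {e : Fin 2 ⊕ κ → E} (he : Function.Injective e)
    (hW : ConvexIndependent ℝ ((↑) : W → E)) {j : κ} (hj : σ j ≠ j) :
    (if e (.inr j) ∈ W then 1 else 0) + (if oppositeFamily σ e (.inr j) ∈ W then 1 else 0) +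
      ((if e (.inr (σ j)) ∈ W then 1 else 0) +
        (if oppositeFamily σ e (.inr (σ j)) ∈ W then 1 else 0)) ≤ 2 := by
  have hne : e (.inr j) ≠ e (.inr (σ j)) := he.ne fun h => hj (Sum.inr_injective h).symm
  let g : ℝ →ᵃ[ℝ] E := AffineMap.lineMap (e (.inr j)) (e (.inr (σ j)))
  have h0 : g 0 = e (.inr j) := AffineMap.lineMap_apply_zero _ _
  have h1 : g 1 = e (.inr (σ j)) := AffineMap.lineMap_apply_one _ _
  have hneg : g (-1) = oppositeFamily σ e (.inr j) := by
    simp only [g, AffineMap.lineMap_apply_module, oppositeFamily, Sum.elim_inr]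
    module
  have h2 : g 2 = oppositeFamily σ e (.inr (σ j)) := by
    simp only [g, AffineMap.lineMap_apply_module, oppositeFamily, Sum.elim_inr, hσ j]
    module
  have hcard : (({0, -1, 1, 2} : Finset ℝ).filter (· ∈ g ⁻¹' W)).card ≤ 2 := by
    rw [← Nat.cast_le (α := ℕ∞), ← Set.encard_coe_eq_coe_finsetCard, Finset.coe_filter]
    exact (Set.encard_le_encard fun t ht => ht.2).trans (encard_lineMap_preimage_le_two hW hne)
  rw [Finset.card_filter, Finset.sum_insert (by norm_num), Finset.sum_insert (by norm_num),
    Finset.sum_insert (by norm_num), Finset.sum_singleton] at hcard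
  simp only [Set.mem_preimage, h0, h1, h2, hneg] at hcard
  lia

open Classical in
theorem ncard_setOf_eq_sum [Fintype κ] (p : κ → Prop) :
    {j | p j}.ncard = ∑ j, if p j then 1 else 0 := by
  rw [← Finset.card_filter, ← Set.ncard_coe_finset, Finset.coe_filter_univ]

theorem ncard_setOf_mem_add_ncard_setOf_mem_le [Fintype κ] (hσ : σ.Involutive)
    {e : Fin 2 ⊕ κ → E} (he : Function.Injective e) (hW : ConvexIndependent ℝ ((↑) : W → E)) :
    {j | e (.inr j) ∈ W}.ncard + {j | oppositeFamily σ e (.inr j) ∈ W}.ncard ≤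
      Fintype.card κ + {j | σ j = j}.ncard := by
  classical
  simp only [ncard_setOf_eq_sum, Fintype.card_eq_sum_ones, ← Finset.sum_add_distrib]
  refine sum_le_sum_of_involutive hσ fun j => ?_
  by_cases hj : σ j = j
  · rw [if_pos hj]
    split_ifs <;> lia
  · rw [if_neg hj]
    exact sum_ite_mem_le_two hσ he hW hj

theorem ncard_inter_pyramidVertices_le [Finite κ] (e : Fin 2 ⊕ κ → E) (S : Set ℝ) (W : Set E) :
    (W ∩ pyramidVertices e S).ncard ≤
      (parabolaPoint e '' S ∩ W).ncard + {j | e (.inr j) ∈ W}.ncard := by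
  have hrange : Set.range (e ∘ Sum.inr) ∩ W = (e ∘ Sum.inr) '' {j | e (.inr j) ∈ W} :=
    Set.image_preimage_eq_range_inter.symm
  rw [Set.inter_comm, pyramidVertices, Set.union_inter_distrib_right, hrange]
  exact (Set.ncard_union_le _ _).trans (Nat.add_le_add_left (Set.ncard_image_le) _)

theorem ncard_inter_add_ncard_inter_le [Fintype κ] (hσ : σ.Involutive)
    (e : Module.Basis (Fin 2 ⊕ κ) ℝ E) {S : Set ℝ} (hS : S ⊆ Set.Icc 0 1)
    (hW : ConvexIndependent ℝ ((↑) : W → E)) {q : E}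
    (hq : W ∩ parabolaPoint (oppositeFamily σ e) '' S = {q}) :
    (W ∩ pyramidVertices e S).ncard + (W ∩ pyramidVertices (oppositeFamily σ e) S).ncard ≤
      Fintype.card κ + {j | σ j = j}.ncard + 3 := by
  have he := ncard_inter_pyramidVertices_le e S W
  have hopp := ncard_inter_pyramidVertices_le (oppositeFamily σ e) S W
  have hapex := ncard_setOf_mem_add_ncard_setOf_mem_le hσ e.injective hW
  obtain ⟨hqW, s, hs, rfl⟩ : q ∈ W ∩ parabolaPoint (oppositeFamily σ e) '' S := hq ▸ rfl
  rw [parabolaPoint_oppositeFamily] at hqW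
  have htwo : (parabolaPoint e '' S ∩ W).ncard ≤ 2 :=
    ENat.toNat_le_of_le_natCast (encard_image_parabolaPoint_inter_le_two e hW hS (hS hs).1 hqW)
  rw [Set.inter_comm _ W, hq, Set.ncard_singleton] at hopp
  lia

end Opposite

section LowerBound

theorem ncard_symmDiff_add {α : Type*} {s t : Set α} (hs : s.Finite) (ht : t.Finite) :
    (s ∆ t).ncard + 2 * (s ∩ t).ncard = s.ncard + t.ncard := by
  have hst := Set.ncard_inter_add_ncard_sdiff_eq_ncard s t hs
  have hts := Set.ncard_inter_add_ncard_sdiff_eq_ncard t s ht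
  rw [Set.inter_comm] at hts
  rw [Set.symmDiff_def, Set.ncard_union_eq disjoint_sdiff_sdiff hs.sdiff ht.sdiff]
  lia

theorem ncard_symmDiff_triangle {α : Type*} {s t u : Set α} (hs : s.Finite) (ht : t.Finite)
    (hu : u.Finite) : (s ∆ u).ncard ≤ (s ∆ t).ncard + (t ∆ u).ncard :=
  (Set.ncard_le_ncard (symmDiff_triangle s t u) ((hs.symmDiff ht).union (ht.symmDiff hu))).trans
    (Set.ncard_union_le _ _)

theorem ncard_symmDiff_of_covBy {α : Type*} {s t : Set α} (h : s ⋖ t) : (s ∆ t).ncard = 1 := by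
  obtain ⟨x, hx, rfl⟩ := Set.covBy_iff_exists_insert.1 h
  rw [symmDiff_of_le h.le, Set.insert_sdiff_of_notMem _ hx, Set.sdiff_self, insert_empty_eq,
    Set.ncard_singleton]

variable {d n : ℕ}

local notation "𝔼" => EuclideanSpace ℝ (Fin d)

theorem ncard_symmDiff_vertices_of_adj {P Q : Polytope d} (h : (Gamma d).Adj P Q) :
    (P.vertices ∆ Q.vertices).ncard = 1 := by
  rcases gamma_adj_iff_covBy.1 h with h | h
  · exact ncard_symmDiff_of_covBy h
  · rw [symmDiff_comm, ncard_symmDiff_of_covBy h]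

theorem ncard_symmDiff_vertices_le_length {P Q : level d n} (p : (GammaLevel d n).Walk P Q) :
    (P.1.vertices ∆ Q.1.vertices).ncard ≤ p.length := by
  induction p with
  | nil => simp
  | @cons P R Q h p ih =>
    have hPR := ncard_symmDiff_vertices_of_adj (SimpleGraph.induce_adj.1 h)
    have hPQ := ncard_symmDiff_triangle P.1.finite_vertices R.1.finite_vertices Q.1.finite_vertices
    rw [SimpleGraph.Walk.length_cons]
    omega

theorem ncard_symmDiff_add_ncard_symmDiff_le_length {P Q R : level d n}
    (p : (GammaLevel d n).Walk P Q) (hR : R ∈ p.support) :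
    (P.1.vertices ∆ R.1.vertices).ncard + (R.1.vertices ∆ Q.1.vertices).ncard ≤ p.length := by
  classical
  rw [← p.take_spec hR, SimpleGraph.Walk.length_append]
  exact add_le_add (ncard_symmDiff_vertices_le_length _) (ncard_symmDiff_vertices_le_length _)

theorem numVertices_eq_and_inter_eq_singleton_of_adj {P R : level d n}
    (h : (GammaLevel d n).Adj P R) {S : Set 𝔼} (hP : Disjoint P.1.vertices S)
    (hR : ¬Disjoint R.1.vertices S) :
    R.1.numVertices = n + 1 ∧ ∃ q, R.1.vertices ∩ S = {q} := by
  rcases gamma_adj_iff_covBy.1 (SimpleGraph.induce_adj.1 h) with hPR | hRP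
  · obtain ⟨q, hq, hRq⟩ := Set.covBy_iff_exists_insert.1 hPR
    have hRcard : R.1.numVertices = P.1.numVertices + 1 := by
      rw [Polytope.numVertices, ← hRq, Set.ncard_insert_of_notMem hq P.1.finite_vertices,
        Polytope.numVertices]
    have hPn : P.1.numVertices = n ∨ P.1.numVertices = n + 1 := P.2
    have hRn : R.1.numVertices = n ∨ R.1.numVertices = n + 1 := R.2
    have hqS : q ∈ S := by
      by_contra hqS
      exact hR (hRq ▸ Set.disjoint_insert_left.2 ⟨hqS, hP⟩)
    refine ⟨by lia, q, ?_⟩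
    rw [← hRq, Set.insert_inter_of_mem hqS, hP.inter_eq, insert_empty_eq]
  · exact absurd (hP.mono_left hRP.le) hR

theorem exists_mem_support_inter_eq_singleton {P Q : level d n} (p : (GammaLevel d n).Walk P Q)
    {S : Set 𝔼} (hP : Disjoint P.1.vertices S) (hQ : ¬Disjoint Q.1.vertices S) :
    ∃ R ∈ p.support, R.1.numVertices = n + 1 ∧ ∃ q, R.1.vertices ∩ S = {q} := by
  obtain ⟨a, ha, hfst, hsnd⟩ := p.exists_boundary_dart {R | Disjoint R.1.vertices S} hP hQ
  exact ⟨a.snd, p.dart_snd_mem_support_of_mem_darts ha,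
    numVertices_eq_and_inter_eq_singleton_of_adj a.adj hfst hsnd⟩

variable {κ : Type*} [Fintype κ]

theorem exists_vertices_eq_pyramidVertices (e : Module.Basis (Fin 2 ⊕ κ) ℝ 𝔼) {S : Set ℝ}
    (hS : 2 < S.ncard) (hn : S.ncard + Fintype.card κ = n + 1) :
    ∃ P : level d n, P.1.vertices = pyramidVertices e S ∧ P.1.numVertices = n + 1 := by
  have hfin : S.Finite := Set.finite_of_ncard_pos (by lia)
  have hvert := Polytope.vertices_hull (finite_pyramidVertices e hfin)
    (affineSpan_pyramidVertices e hS) (convexIndependent_pyramidVertices e S)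
  have hnum : (Polytope.hull _ (finite_pyramidVertices e hfin)
      (affineSpan_pyramidVertices e hS)).numVertices = n + 1 := by
    rw [Polytope.numVertices, hvert, ncard_pyramidVertices e hfin, hn]
  exact ⟨⟨_, .inr hnum⟩, hvert, hnum⟩

theorem numVertices_add_numVertices_le_length {σ : κ → κ} (hσ : σ.Involutive)
    (e : Module.Basis (Fin 2 ⊕ κ) ℝ 𝔼) {S : Set ℝ} (hS : S ⊆ Set.Icc 0 1) (hne : S.Nonempty)
    {P Q : level d n} (hP : P.1.vertices = pyramidVertices e S)
    (hQ : Q.1.vertices = pyramidVertices (oppositeFamily σ e) S)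
    (p : (GammaLevel d n).Walk P Q) :
    P.1.numVertices + Q.1.numVertices + 2 * (n + 1) ≤
      p.length + 2 * (Fintype.card κ + {j | σ j = j}.ncard + 3) := by
  have hPbase : Disjoint P.1.vertices (parabolaPoint (oppositeFamily σ e) '' S) :=
    hP ▸ disjoint_pyramidVertices_oppositeFamily e S S
  have hQbase : ¬Disjoint Q.1.vertices (parabolaPoint (oppositeFamily σ e) '' S) := by
    obtain ⟨x, hx⟩ := hne.image (parabolaPoint (oppositeFamily σ e))
    exact Set.not_disjoint_iff.2 ⟨x, hQ ▸ .inl hx, hx⟩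
  obtain ⟨R, hR, hRn, q, hq⟩ := exists_mem_support_inter_eq_singleton p hPbase hQbase
  have hshared := ncard_inter_add_ncard_inter_le hσ e hS R.1.convexIndependent_vertices hq
  have hlength := ncard_symmDiff_add_ncard_symmDiff_le_length p hR
  have hPR := ncard_symmDiff_add P.1.finite_vertices R.1.finite_vertices
  have hRQ := ncard_symmDiff_add R.1.finite_vertices Q.1.finite_vertices
  rw [← hP, ← hQ, Set.inter_comm _ P.1.vertices] at hshared
  simp only [Polytope.numVertices] at hRn ⊢
  lia

theorem exists_le_edist (hd : 2 ≤ d) (hn : d + 1 ≤ n) :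
    ∃ P Q : level d n, ((4 * n - 2 * d : ℕ) : ℕ∞) ≤ (GammaLevel d n).edist P Q := by
  let e : Module.Basis (Fin 2 ⊕ Fin (d - 2)) ℝ 𝔼 :=
    (EuclideanSpace.basisFun (Fin d) ℝ).toBasis.reindex
      (Fintype.equivOfCardEq (by simp only [Fintype.card_sum, Fintype.card_fin]; lia))
  have hσ : Function.Involutive (Fin.rev (n := d - 2)) := Fin.rev_involutive
  have hfix : {j : Fin (d - 2) | j.rev = j}.ncard ≤ 1 :=
    Set.ncard_le_one_iff_subsingleton.2 fun i (hi : i.rev = i) j (hj : j.rev = j) => by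
      rw [Fin.ext_iff, Fin.val_rev] at hi hj
      lia
  obtain ⟨S, hS, hScard⟩ := (Set.Icc_infinite (zero_lt_one (α := ℝ))).exists_subset_card_eq
    (n + 3 - d)
  rw [← Set.ncard_coe_finset] at hScard
  have hn' : (S : Set ℝ).ncard + Fintype.card (Fin (d - 2)) = n + 1 := by
    rw [hScard, Fintype.card_fin]
    lia
  obtain ⟨P, hP, hPn⟩ := exists_vertices_eq_pyramidVertices e (by lia) hn'
  obtain ⟨Q, hQ, hQn⟩ := exists_vertices_eq_pyramidVertices (oppositeBasis hσ e) (by lia) hn'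
  rw [coe_oppositeBasis] at hQ
  have hne : (S : Set ℝ).Nonempty := Set.nonempty_of_ncard_ne_zero (by lia)
  refine ⟨P, Q, ?_⟩
  rw [SimpleGraph.edist_eq_sInf]
  refine le_sInf ?_
  rintro _ ⟨p, rfl⟩
  have hlength := numVertices_add_numVertices_le_length hσ e hS hne hP hQ p
  rw [Fintype.card_fin] at hlength
  exact Nat.cast_le.2 (by lia)

end LowerBound

end PolytopeGraph

theorem theorem1 (d n : ℕ) (hd : 2 ≤ d) (hn : d + 1 ≤ n) :
    (PolytopeGraph.GammaLevel d n).Connected ∧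
    ((4 * n - 2 * d : ℕ) : ℕ∞) ≤ (PolytopeGraph.GammaLevel d n).ediam ∧
    (PolytopeGraph.GammaLevel d n).ediam ≤ ((6 * n - 2 : ℕ) : ℕ∞) ∧
    (∀ P Q : PolytopeGraph.level d n, P.1.numVertices = n → Q.1.numVertices = n →
      (PolytopeGraph.GammaLevel d n).edist P Q ≤ ((6 * n - 4 : ℕ) : ℕ∞)) := by
  obtain ⟨P, Q, hPQ⟩ := PolytopeGraph.exists_le_edist hd hn
  have hdiam : (PolytopeGraph.GammaLevel d n).ediam ≤ ((6 * n - 2 : ℕ) : ℕ∞) :=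
    SimpleGraph.ediam_le_of_edist_le (PolytopeGraph.edist_le hd hn)
  have : Nonempty (PolytopeGraph.level d n) := ⟨P⟩
  exact ⟨SimpleGraph.connected_of_ediam_ne_top (hdiam.trans_lt (ENat.natCast_lt_top _)).ne,
    hPQ.trans SimpleGraph.edist_le_ediam, hdiam, PolytopeGraph.edist_le_of_numVertices_eq hd hn⟩
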